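/- Let $k$ be an algebraically closed field and let $q$ be a prime number different from the characteristic of $k$. Let $f$ and $g$ be irreducible elements of the ring $k[x][[y]]$ of power series in $y$ whose coefficients are polynomials in $x$ over $k$. Assume that the curve $f=0$ is nonsingular, i.e. that $k[x][[y]]/(f)$ is a regular ring. If $f$ is a $q$-th power modulo $g$ (that is, $g$ divides $f-s^q$ for some $s\in k[x][[y]]$), then $g$ is a $q$-th power modulo $f$ (that is, $f$ divides $g-t^q$ for some $t\in k[x][[y]]$). -/

import Mathlib

/-- `a` is a `q`-th power modulo `b`: it is congruent to a `q`-th power modulo the principal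
ideal generated by `b`. -/
def IsPowModulo {R : Type*} [CommRing R] (q : ℕ) (a b : R) : Prop :=
  ∃ s : R, b ∣ a - s ^ q

/-- The curve `f = 0`, that is the closed subscheme `Spec (R / (f))` of `Spec R`, is nonsingular:
its coordinate ring is regular (noetherian, with all its localizations at prime ideals being
regular local rings). -/
def IsNonsingularCurve {R : Type*} [CommRing R] (f : R) : Prop :=
  IsRegularRing (R ⧸ Ideal.span {f})

open scoped PowerSeries

/-! Let R = k[x][[y]]. The intersection number of the two curves, the length of R/(f, g), is the
order of f on g = 0 and also of g on f = 0 (`Ring.ord_quotient_mk_comm`). If f ≡ s^q mod g, it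
equals q · ord(s). On the nonsingular curve f = 0, g equals v^q t^j with v a unit and t generating a
maximal ideal (`exists_quotient_mk_eq_pow_mul_pow`), so it equals j. Hence q divides j and g is a
q-th power mod f.

The shape v^q t^j comes from Hensel's lemma: an irreducible element is y up to a unit, or its
restriction to y = 0 has a single zero. If f ~ y, then R/(f) = k[x], and g restricts to d(x - b)^m
with d a q-th power in k. Otherwise R/(f) is a discrete valuation ring, Henselian along y, whose
units are q-th powers because k is algebraically closed and q is invertible. -/

/-- Hensel's lemma for factorizations: a coprime factorization of the constant coefficient of a
power series lifts to a factorization of the power series. -/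
theorem PowerSeries.exists_mul_eq_of_isCoprime {A : Type*} [CommRing A] (g : A⟦X⟧) {a b : A}
    (hab : IsCoprime a b) (hg : constantCoeff g = a * b) :
    ∃ a' b' : A⟦X⟧, a' * b' = g ∧ constantCoeff a' = a ∧ constantCoeff b' = b := by
  obtain ⟨u, v, huv⟩ := hab
  set c : A⟦X⟧ := g - C (a * b) with hc
  have hc0 : constantCoeff c = 0 := by simp [hc, hg]
  have hmem : ∀ z : A⟦X⟧, z ∈ Ideal.span {(X : A⟦X⟧)} ↔ constantCoeff z = 0 := fun z => by
    rw [Ideal.mem_span_singleton, X_dvd_iff]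
  -- A root `w ≡ 1` of `w ^ 2 - w - u v c` yields a solution `h = c / w` of `h + u v h ^ 2 = c`.
  obtain ⟨w, hw, hw1⟩ := HenselianRing.is_henselian (R := A⟦X⟧) (I := Ideal.span {X})
    (Polynomial.X ^ 2 - Polynomial.X - Polynomial.C (C (u * v) * c))
    (by
      nontriviality A
      have : Polynomial.X ^ 2 - Polynomial.X - Polynomial.C (C (u * v) * c) =
        Polynomial.X ^ 2 - (Polynomial.X + Polynomial.C (C (u * v) * c)) := by ring
      rw [this]
      exact Polynomial.monic_X_pow_sub (by rw [Polynomial.degree_X_add_C]; norm_num))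
    1 (by rw [hmem]; simp [hc0])
    (by simp only [Polynomial.derivative_sub, Polynomial.derivative_X_pow,
          Polynomial.derivative_X, Polynomial.derivative_C]; norm_num)
  have hw0 : constantCoeff w = 1 := by
    rw [hmem, map_sub, map_one, sub_eq_zero] at hw1; exact hw1
  obtain ⟨w', hw'⟩ : ∃ w', w * w' = 1 := by
    have : IsUnit w := isUnit_iff_constantCoeff.2 (by rw [hw0]; exact isUnit_one)
    exact this.exists_right_inv
  have hroot : w ^ 2 - w - C (u * v) * c = 0 := by simpa [Polynomial.IsRoot] using hw
  have huv' : C u * C a + C v * C b = (1 : A⟦X⟧) := by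
    rw [← map_mul, ← map_mul, ← map_add, huv, map_one]
  have hg' : g = C a * C b + c := by rw [hc, map_mul]; ring
  rw [map_mul] at hroot
  -- With h = c w', the product (a + v h)(b + u h) is ab + (ua + vb)h + uv h² = ab + h + uv h².
  refine ⟨C a + C v * (c * w'), C b + C u * (c * w'), ?_, by simp [hc0], by simp [hc0]⟩
  rw [hg']
  clear_value c
  linear_combination (c * w') * huv' - c * w' ^ 2 * hroot + c * (w * w' - w' + 1) * hw'

/-- The image of a precomplete ring under a surjective ring homomorphism is precomplete. -/
theorem IsPrecomplete.of_surjective_ringHom {R S : Type*} [CommRing R] [CommRing S] (I : Ideal R)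
    [hI : IsPrecomplete I R] (φ : R →+* S) (hφ : Function.Surjective φ) :
    IsPrecomplete (I.map φ) S := by
  refine ⟨fun f hf => ?_⟩
  have key : ∀ n, ∃ d ∈ I ^ n, φ d = f (n + 1) - f n := fun n => by
    rw [← Ideal.mem_map_iff_of_surjective φ hφ, Ideal.map_pow]
    have := (hf n.le_succ).symm
    rwa [SModEq.sub_mem, smul_eq_mul, Ideal.mul_top] at this
  choose d hd hφd using key
  obtain ⟨g0, hg0⟩ := hφ (f 0)
  set g : ℕ → R := fun n => g0 + ∑ i ∈ Finset.range n, d i with hg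
  have hφg : ∀ n, φ (g n) = f n := fun n => by
    simp only [hg, map_add, map_sum, hφd, hg0, Finset.sum_range_sub]; ring
  obtain ⟨L, hL⟩ := hI.prec (f := g) (fun {m n} hmn => by
    rw [SModEq.sub_mem, smul_eq_mul, Ideal.mul_top, ← neg_mem_iff]
    have : -(g m - g n) = ∑ i ∈ Finset.Ico m n, d i := by
      rw [Finset.sum_Ico_eq_sub _ hmn]; simp only [hg]; ring
    rw [this]
    exact Ideal.sum_mem _ fun i hi => Ideal.pow_le_pow_right (Finset.mem_Ico.1 hi).1 (hd i))
  refine ⟨φ L, fun n => ?_⟩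
  have := hL n
  rw [SModEq.sub_mem, smul_eq_mul, Ideal.mul_top] at this ⊢
  rw [← hφg, ← map_sub, ← Ideal.map_pow]
  exact Ideal.mem_map_of_mem _ this

/-- Units of a local ring with algebraically closed coefficient field are `q`-th powers if the
ring is Henselian at an ideal whose radical is the maximal ideal and `q` is invertible. -/
theorem exists_pow_eq_of_isUnit_of_henselianRing {k B : Type*} [Field k] [IsAlgClosed k]
    [CommRing B] [IsLocalRing B] (I : Ideal B) [HenselianRing B I]
    (hI : ∀ h ∈ IsLocalRing.maximalIdeal B, ∃ n : ℕ, h ^ n ∈ I) (i : k →+* B)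
    (hi : ∀ b, ∃ c, b - i c ∈ IsLocalRing.maximalIdeal B) {q : ℕ} (hq : (q : k) ≠ 0)
    {u : B} (hu : IsUnit u) : ∃ v : B, v ^ q = u := by
  have hq0 : q ≠ 0 := by rintro rfl; simp at hq
  obtain ⟨c, hc⟩ := hi u
  obtain ⟨d, rfl⟩ := IsAlgClosed.exists_pow_nat_eq c (Nat.pos_of_ne_zero hq0)
  have hd : d ≠ 0 := by
    rintro rfl
    rw [zero_pow hq0, map_zero, sub_zero] at hc
    exact (IsLocalRing.mem_maximalIdeal _).1 hc hu
  have hqB : IsUnit ((q : ℕ) : B) := by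
    have := (Ne.isUnit hq).map i
    rwa [map_natCast] at this
  let π := Ideal.Quotient.mk I
  -- `u - i (d ^ q)` is only nilpotent modulo `I`, so Newton's iteration first corrects `i d` to a
  -- root in `B ⧸ I`; Hensel then lifts that root to `B`.
  obtain ⟨r, ⟨-, hr⟩, -⟩ := Polynomial.existsUnique_nilpotent_sub_and_aeval_eq_zero
    (R := B ⧸ I) (S := B ⧸ I) (P := Polynomial.X ^ q - Polynomial.C (π u)) (x := π (i d))
    (by
      obtain ⟨n, hn⟩ := hI _ hc
      refine ⟨n, ?_⟩
      have : Polynomial.aeval (π (i d)) (Polynomial.X ^ q - Polynomial.C (π u)) =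
        π (-(u - i (d ^ q))) := by simp
      rw [this, ← map_pow, Ideal.Quotient.eq_zero_iff_mem, neg_pow]
      exact I.mul_mem_left _ hn)
    (by
      have : Polynomial.aeval (π (i d)) (Polynomial.derivative
        (Polynomial.X ^ q - Polynomial.C (π u))) = π (q * i d ^ (q - 1)) := by
        simp [Polynomial.derivative_X_pow]
      rw [this]
      exact (hqB.mul (((Ne.isUnit hd).map i).pow _)).map π)
  obtain ⟨r, rfl⟩ := Ideal.Quotient.mk_surjective r
  have hr' : π r ^ q = π u := by simpa [sub_eq_zero] using hr
  have hru : IsUnit (π r) := by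
    rw [← isUnit_pow_iff hq0, hr']; exact hu.map π
  obtain ⟨v, hv, -⟩ := HenselianRing.is_henselian (I := I)
    (Polynomial.X ^ q - Polynomial.C u) (Polynomial.monic_X_pow_sub_C u hq0) r
    (by
      rw [← Ideal.Quotient.eq_zero_iff_mem]
      simp only [Polynomial.eval_sub, Polynomial.eval_pow, Polynomial.eval_X, Polynomial.eval_C,
        map_sub, map_pow, sub_eq_zero]
      exact hr')
    (by
      simp only [Polynomial.derivative_sub, Polynomial.derivative_X_pow, Polynomial.derivative_C,
        sub_zero, Polynomial.eval_mul, Polynomial.eval_pow, Polynomial.eval_X, map_mul, map_pow,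
        Polynomial.eval_C]
      exact (hqB.map π).mul (hru.pow _))
  exact ⟨v, by simpa [Polynomial.IsRoot, sub_eq_zero] using hv⟩

/-! ### Intersection numbers. -/

/-- The symmetry of the intersection number of two elements. -/
theorem Ring.ord_quotient_mk_comm {R : Type*} [CommRing R] (a b : R) :
    Ring.ord (R ⧸ Ideal.span {a}) (Ideal.Quotient.mk _ b) =
      Ring.ord (R ⧸ Ideal.span {b}) (Ideal.Quotient.mk _ a) := by
  have key : ∀ a b : R, Ring.ord (R ⧸ Ideal.span {a}) (Ideal.Quotient.mk _ b) =
      Module.length R (R ⧸ (Ideal.span {a} ⊔ Ideal.span {b})) := fun a b => by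
    rw [Ring.ord, ← Module.length_eq_of_surjective (S := R) Ideal.Quotient.mk_surjective]
    have h : Ideal.span {Ideal.Quotient.mk (Ideal.span {a}) b} =
        (Ideal.span {b}).map (Ideal.Quotient.mkₐ R (Ideal.span {a})) := by
      rw [Ideal.map_span, Set.image_singleton]; rfl
    exact ((Ideal.quotientEquivAlgOfEq R h).trans
      (DoubleQuot.quotQuotEquivQuotSupₐ R _ _)).toLinearEquiv.length_eq
  rw [key, key, sup_comm]

/-- An element spanning a maximal ideal has order of vanishing one. -/
theorem Ring.ord_eq_one_of_isMaximal {R : Type*} [CommRing R] {t : R}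
    (ht : (Ideal.span {t}).IsMaximal) : Ring.ord R t = 1 := by
  rw [Ring.ord, Module.length_eq_one_iff, isSimpleModule_iff_isCoatom, ← Ideal.isMaximal_def]
  exact ht
-- Irreducible elements of k[x][[y]].
namespace PowerSeries

/-- An irreducible element of `k[x]⟦y⟧` is associated to `y`, or its reduction modulo `y` is a
nonzero scalar times a positive power of a linear polynomial. -/
theorem associated_X_or_constantCoeff_eq_of_irreducible {k : Type*} [Field k] [IsAlgClosed k]
    {g : (Polynomial k)⟦X⟧} (hg : Irreducible g) :
    Associated g X ∨ ∃ (c a : k) (m : ℕ), c ≠ 0 ∧ m ≠ 0 ∧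
      constantCoeff g = Polynomial.C c * (Polynomial.X - Polynomial.C a) ^ m := by
  rw [or_iff_not_imp_left]
  intro hgX
  have hg0 : constantCoeff g ≠ 0 := fun h =>
    hgX ((X_irreducible.associated_of_dvd hg (X_dvd_iff.2 h)).symm)
  have hdeg : (constantCoeff g).degree ≠ 0 := fun h =>
    hg.not_isUnit (isUnit_iff_constantCoeff.2 (Polynomial.isUnit_iff_degree_eq_zero.2 h))
  obtain ⟨a, ha⟩ := IsAlgClosed.exists_root _ hdeg
  obtain ⟨p, hp, hpa⟩ := Polynomial.exists_eq_pow_rootMultiplicity_mul_and_not_dvd _ hg0 a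
  have hm : (constantCoeff g).rootMultiplicity a ≠ 0 :=
    ((Polynomial.rootMultiplicity_pos hg0).2 ha).ne'
  set m := (constantCoeff g).rootMultiplicity a
  have hcop : IsCoprime ((Polynomial.X - Polynomial.C a) ^ m) p :=
    (((Polynomial.irreducible_X_sub_C a).coprime_iff_not_dvd).2 hpa).pow_left
  obtain ⟨a', b', hab, ha', hb'⟩ := exists_mul_eq_of_isCoprime g hcop hp
  rcases hg.isUnit_or_isUnit hab.symm with h | h
  · rw [isUnit_iff_constantCoeff, ha', isUnit_pow_iff hm] at h
    exact absurd h (Polynomial.not_isUnit_X_sub_C a)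
  · rw [isUnit_iff_constantCoeff, hb', Polynomial.isUnit_iff] at h
    obtain ⟨c, hc, rfl⟩ := h
    exact ⟨c, a, m, hc.ne_zero, hm, by rw [hp, mul_comm]⟩

/-- The value of an element of `k[x]⟦y⟧` at the point `(a, 0)`. -/
noncomputable def evalAt {k : Type*} [Field k] (a : k) : (Polynomial k)⟦X⟧ →+* k :=
  (Polynomial.evalRingHom a).comp constantCoeff

/-! ### The local ring of a branch through (a, 0). -/

section Branch

variable {k : Type*} [Field k] {f : (Polynomial k)⟦X⟧} {c a : k} {n : ℕ}

theorem evalAt_apply (a : k) (h : (Polynomial k)⟦X⟧) :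
    evalAt a h = (constantCoeff h).eval a := rfl

theorem evalAt_C_C (a d : k) : evalAt a (C (Polynomial.C d)) = d := by
  simp [evalAt_apply]

/-- The value at `(a, 0)` of a function on the curve `f = 0`. -/
noncomputable def evalAtQuotient (hn : n ≠ 0)
    (hf : constantCoeff f = Polynomial.C c * (Polynomial.X - Polynomial.C a) ^ n) :
    (Polynomial k)⟦X⟧ ⧸ Ideal.span {f} →+* k :=
  Ideal.Quotient.lift _ (evalAt a) (fun z hz => by
    obtain ⟨w, rfl⟩ := Ideal.mem_span_singleton.1 hz
    simp [evalAt_apply, hf, hn])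

variable (hc : c ≠ 0) (hn : n ≠ 0)
  (hf : constantCoeff f = Polynomial.C c * (Polynomial.X - Polynomial.C a) ^ n)

theorem evalAtQuotient_mk (h : (Polynomial k)⟦X⟧) :
    evalAtQuotient hn hf (Ideal.Quotient.mk _ h) = evalAt a h := rfl

-- If h(a, 0) ≠ 0, then h(x, 0) is coprime to f(x, 0); a Bézout relation gives a combination of h
-- and f with constant coefficient 1, hence a unit.
include hc in
theorem isLocalHom_evalAtQuotient : IsLocalHom (evalAtQuotient hn hf) := by
  refine ⟨fun z hz => ?_⟩
  obtain ⟨h, rfl⟩ := Ideal.Quotient.mk_surjective z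
  rw [evalAtQuotient_mk, evalAt_apply] at hz
  have hcop : IsCoprime (constantCoeff h) (constantCoeff f) := by
    rw [hf]
    refine IsCoprime.symm ((isCoprime_mul_unit_left_left
      (Polynomial.isUnit_C.2 hc.isUnit) _ _).2 (IsCoprime.pow_left ?_))
    rw [(Polynomial.irreducible_X_sub_C a).coprime_iff_not_dvd, Polynomial.dvd_iff_isRoot]
    exact hz.ne_zero
  obtain ⟨α, β, h1⟩ := hcop
  have hu : IsUnit (C α * h + C β * f) :=
    isUnit_iff_constantCoeff.2 (by simp [h1])
  have := hu.map (Ideal.Quotient.mk (Ideal.span {f}))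
  rw [map_add, map_mul, map_mul,
    Ideal.Quotient.eq_zero_iff_mem.2 (Ideal.mem_span_singleton_self f), mul_zero, add_zero] at this
  exact isUnit_of_mul_isUnit_right this

include hc hn hf in
theorem isLocalRing_quotient_span : IsLocalRing ((Polynomial k)⟦X⟧ ⧸ Ideal.span {f}) :=
  have := isLocalHom_evalAtQuotient hc hn hf
  RingHom.domain_isLocalRing (evalAtQuotient hn hf)

section Local

variable [IsLocalRing ((Polynomial k)⟦X⟧ ⧸ Ideal.span {f})]

include hc in
theorem mem_maximalIdeal_iff_evalAtQuotient (z : (Polynomial k)⟦X⟧ ⧸ Ideal.span {f}) :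
    z ∈ IsLocalRing.maximalIdeal _ ↔ evalAtQuotient hn hf z = 0 := by
  have := isLocalHom_evalAtQuotient hc hn hf
  rw [IsLocalRing.mem_maximalIdeal, mem_nonunits_iff, ← isUnit_map_iff (evalAtQuotient hn hf),
    isUnit_iff_ne_zero, not_not]

-- The maximal ideal is the radical of (y): if h(x, 0) = (x - a)p, then h^n ≡ c⁻¹ p^n f mod y.
include hc hn hf in
theorem pow_mem_span_mk_X_of_mem_maximalIdeal {z : (Polynomial k)⟦X⟧ ⧸ Ideal.span {f}}
    (hz : z ∈ IsLocalRing.maximalIdeal _) :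
    z ^ n ∈ Ideal.span {Ideal.Quotient.mk (Ideal.span {f}) X} := by
  rw [mem_maximalIdeal_iff_evalAtQuotient hc hn hf] at hz
  obtain ⟨h, rfl⟩ := Ideal.Quotient.mk_surjective z
  rw [evalAtQuotient_mk, evalAt_apply, ← Polynomial.IsRoot, ← Polynomial.dvd_iff_isRoot] at hz
  obtain ⟨p, hp⟩ := hz
  have hX : (X : (Polynomial k)⟦X⟧) ∣ h ^ n - f * C (Polynomial.C c⁻¹ * p ^ n) := by
    rw [X_dvd_iff, map_sub, map_pow, map_mul, hp, hf, constantCoeff_C, mul_pow]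
    have : Polynomial.C c * Polynomial.C c⁻¹ = 1 := by
      rw [← Polynomial.C_mul, mul_inv_cancel₀ hc, Polynomial.C_1]
    linear_combination (-(Polynomial.X - Polynomial.C a) ^ n * p ^ n) * this
  have := map_dvd (Ideal.Quotient.mk (Ideal.span {f})) hX
  rw [map_sub, map_mul,
    Ideal.Quotient.eq_zero_iff_mem.2 (Ideal.mem_span_singleton_self f), zero_mul, sub_zero,
    map_pow] at this
  exact Ideal.mem_span_singleton.2 this

include hc hn hf in
theorem mk_X_mem_maximalIdeal :
    Ideal.Quotient.mk (Ideal.span {f}) X ∈ IsLocalRing.maximalIdeal _ := by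
  rw [mem_maximalIdeal_iff_evalAtQuotient hc hn hf, evalAtQuotient_mk, evalAt_apply]
  simp

include hc hn hf in
theorem exists_sub_C_mem_maximalIdeal (z : (Polynomial k)⟦X⟧ ⧸ Ideal.span {f}) :
    ∃ d : k, z - Ideal.Quotient.mk _ (C (Polynomial.C d)) ∈ IsLocalRing.maximalIdeal _ := by
  obtain ⟨h, rfl⟩ := Ideal.Quotient.mk_surjective z
  refine ⟨evalAt a h, ?_⟩
  rw [mem_maximalIdeal_iff_evalAtQuotient hc hn hf, map_sub, evalAtQuotient_mk,
    evalAtQuotient_mk, evalAt_C_C, sub_self]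

-- Precompleteness along y descends from k[x][[y]]; separatedness is Krull's intersection theorem.
include hc hn hf in
theorem henselianRing_quotient_span :
    HenselianRing ((Polynomial k)⟦X⟧ ⧸ Ideal.span {f})
      (Ideal.span {Ideal.Quotient.mk (Ideal.span {f}) X}) := by
  have h1 : IsPrecomplete (Ideal.span {Ideal.Quotient.mk (Ideal.span {f}) X})
      ((Polynomial k)⟦X⟧ ⧸ Ideal.span {f}) := by
    have := IsPrecomplete.of_surjective_ringHom (Ideal.span {(X : (Polynomial k)⟦X⟧)})
      (Ideal.Quotient.mk (Ideal.span {f})) Ideal.Quotient.mk_surjective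
    rwa [Ideal.map_span, Set.image_singleton] at this
  have hle : Ideal.span {Ideal.Quotient.mk (Ideal.span {f}) X} ≤ IsLocalRing.maximalIdeal _ := by
    rw [Ideal.span_singleton_le_iff_mem]
    exact mk_X_mem_maximalIdeal hc hn hf
  have h2 : IsHausdorff (Ideal.span {Ideal.Quotient.mk (Ideal.span {f}) X})
      ((Polynomial k)⟦X⟧ ⧸ Ideal.span {f}) := by
    refine isHausdorff_iff.2 fun z hz => ?_
    have : z ∈ (⨅ i : ℕ, IsLocalRing.maximalIdeal ((Polynomial k)⟦X⟧ ⧸ Ideal.span {f}) ^ i) := by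
      refine Ideal.mem_iInf.2 fun i => ?_
      have := hz i
      rw [SModEq.zero, smul_eq_mul, Ideal.mul_top] at this
      exact Ideal.pow_right_mono hle i this
    rwa [Ideal.iInf_pow_eq_bot_of_isLocalRing _ Ideal.IsPrime.ne_top', Ideal.mem_bot] at this
  have : IsAdicComplete (Ideal.span {Ideal.Quotient.mk (Ideal.span {f}) X})
      ((Polynomial k)⟦X⟧ ⧸ Ideal.span {f}) := { h1, h2 with }
  infer_instance

end Local

-- The maximal ideal is minimal over (y), so its height is at most 1 by Krull; regularity bounds the
-- cotangent space by the same number.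
include hc hn hf in
theorem isDiscreteValuationRing_quotient_span
    [IsDomain ((Polynomial k)⟦X⟧ ⧸ Ideal.span {f})]
    [IsRegularLocalRing ((Polynomial k)⟦X⟧ ⧸ Ideal.span {f})]
    (hX : ¬ f ∣ X) :
    IsDiscreteValuationRing ((Polynomial k)⟦X⟧ ⧸ Ideal.span {f}) := by
  have hmX := mk_X_mem_maximalIdeal hc hn hf
  have hX0 : Ideal.Quotient.mk (Ideal.span {f}) X ≠ 0 := by
    rwa [Ne, Ideal.Quotient.eq_zero_iff_mem, Ideal.mem_span_singleton]
  have hfield : ¬ IsField ((Polynomial k)⟦X⟧ ⧸ Ideal.span {f}) := by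
    rw [IsLocalRing.isField_iff_maximalIdeal_eq]
    intro h
    rw [h] at hmX
    exact hX0 hmX
  refine ((IsDiscreteValuationRing.TFAE _ hfield).out 0 4).2 ?_
  rw [← IsLocalRing.finrank_cotangentSpace_le_one_iff]
  have hreg := (IsRegularLocalRing.iff_finrank_cotangentSpace
    ((Polynomial k)⟦X⟧ ⧸ Ideal.span {f})).1 inferInstance
  have hht : (IsLocalRing.maximalIdeal ((Polynomial k)⟦X⟧ ⧸ Ideal.span {f})).height ≤ 1 := by
    refine Ideal.height_le_one_of_isPrincipal_of_mem_minimalPrimes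
      (Ideal.span {Ideal.Quotient.mk (Ideal.span {f}) X}) _ ⟨⟨inferInstance, ?_⟩, ?_⟩
    · rwa [Ideal.span_singleton_le_iff_mem]
    · rintro P ⟨hP, hXP⟩ - z hz
      exact hP.mem_of_pow_mem n (hXP (pow_mem_span_mk_X_of_mem_maximalIdeal hc hn hf hz))
  rw [← IsLocalRing.maximalIdeal_height_eq_ringKrullDim] at hreg
  have : ((Module.finrank (IsLocalRing.ResidueField ((Polynomial k)⟦X⟧ ⧸ Ideal.span {f}))
    (IsLocalRing.CotangentSpace ((Polynomial k)⟦X⟧ ⧸ Ideal.span {f})) : ℕ∞)) ≤ 1 := by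
    have h := hreg.le
    exact le_trans (by exact_mod_cast h) hht
  exact_mod_cast this

end Branch

/-! ### The axis y = 0, and the local form of g on f = 0. -/

/-- The curve `y = 0` meets the curve `x = b` in a reduced point. -/
theorem isMaximal_span_mk_of_associated_X {k : Type*} [Field k] {f : (Polynomial k)⟦X⟧}
    (hf : Associated f X) (b : k) :
    (Ideal.span {Ideal.Quotient.mk (Ideal.span {f})
      (C (Polynomial.X - Polynomial.C b))}).IsMaximal := by
  have hsurj : Function.Surjective (evalAt b) := fun d => ⟨_, evalAt_C_C b d⟩
  have hle : ∀ z ∈ Ideal.span {f}, evalAt b z = 0 := fun z hz => by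
    obtain ⟨w, rfl⟩ := Ideal.mem_span_singleton.1 hz
    obtain ⟨u, hu⟩ := hf.symm
    rw [← hu]
    simp [evalAt_apply]
  have hmax := RingHom.ker_isMaximal_of_surjective (Ideal.Quotient.lift _ (evalAt b) hle)
    (Ideal.Quotient.lift_surjective_of_surjective _ _ hsurj)
  suffices heq : Ideal.span {Ideal.Quotient.mk (Ideal.span {f}) (C (Polynomial.X - Polynomial.C b))} =
      RingHom.ker (Ideal.Quotient.lift _ (evalAt b) hle) by
    rw [heq]; exact hmax
  refine le_antisymm ?_ fun z hz => ?_
  · rw [Ideal.span_singleton_le_iff_mem, RingHom.mem_ker, Ideal.Quotient.lift_mk, evalAt_apply]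
    simp
  · obtain ⟨h, rfl⟩ := Ideal.Quotient.mk_surjective z
    rw [RingHom.mem_ker, Ideal.Quotient.lift_mk, evalAt_apply, ← Polynomial.IsRoot,
      ← Polynomial.dvd_iff_isRoot] at hz
    obtain ⟨p, hp⟩ := hz
    have hX : f ∣ h - C (Polynomial.X - Polynomial.C b) * C p := by
      rw [hf.dvd_iff_dvd_left, X_dvd_iff, map_sub, hp]
      simp
    rw [Ideal.mem_span_singleton, ← sub_add_cancel h (C (Polynomial.X - Polynomial.C b) * C p),
      map_add, Ideal.Quotient.eq_zero_iff_mem.2 (Ideal.mem_span_singleton.2 hX), zero_add, map_mul]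
    exact dvd_mul_right _ _

/-- On a nonsingular irreducible curve `f = 0`, every irreducible `g` that does not vanish
identically is a `q`-th power times a power of a generator of a maximal ideal. -/
theorem exists_quotient_mk_eq_pow_mul_pow {k : Type*} [Field k] [IsAlgClosed k] {q : ℕ}
    (hq : (q : k) ≠ 0) {f g : (Polynomial k)⟦X⟧} (hf : Irreducible f) (hg : Irreducible g)
    [IsRegularRing ((Polynomial k)⟦X⟧ ⧸ Ideal.span {f})] (hfg : ¬ Associated f g) :
    ∃ (v t : (Polynomial k)⟦X⟧ ⧸ Ideal.span {f}) (j : ℕ), (Ideal.span {t}).IsMaximal ∧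
      IsUnit v ∧ t ≠ 0 ∧ Ideal.Quotient.mk (Ideal.span {f}) g = v ^ q * t ^ j := by
  have hq0 : q ≠ 0 := by rintro rfl; simp at hq
  rcases associated_X_or_constantCoeff_eq_of_irreducible hf with hfX | ⟨c, a, n, hc, hn, hfc⟩
  · rcases associated_X_or_constantCoeff_eq_of_irreducible hg with hgX | ⟨d, b, m, hd, -, hgc⟩
    · exact absurd (hfX.trans hgX.symm) hfg
    obtain ⟨e, rfl⟩ := IsAlgClosed.exists_pow_nat_eq d (Nat.pos_of_ne_zero hq0)
    have he : e ≠ 0 := by rintro rfl; simp [hq0] at hd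
    refine ⟨Ideal.Quotient.mk _ (C (Polynomial.C e)), _, m,
      isMaximal_span_mk_of_associated_X hfX b, ?_, ?_, ?_⟩
    · exact ((he.isUnit.map Polynomial.C).map C).map _
    · rw [Ne, Ideal.Quotient.eq_zero_iff_mem, Ideal.mem_span_singleton, hfX.dvd_iff_dvd_left,
        X_dvd_iff, constantCoeff_C]
      exact Polynomial.X_sub_C_ne_zero b
    · rw [← map_pow (Ideal.Quotient.mk _), ← map_pow (Ideal.Quotient.mk _), ← map_mul, Ideal.Quotient.mk_eq_mk_iff_sub_mem,
        Ideal.mem_span_singleton, hfX.dvd_iff_dvd_left, X_dvd_iff, map_sub, hgc]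
      simp
  · have := isLocalRing_quotient_span hc hn hfc
    have : IsRegularLocalRing ((Polynomial k)⟦X⟧ ⧸ Ideal.span {f}) :=
      .of_isRegularRing_of_isLocalRing _
    have : (Ideal.span {f}).IsPrime := (Ideal.span_singleton_prime hf.ne_zero).2 hf.prime
    have hfX : ¬ f ∣ X := fun h => by
      obtain ⟨u, hu⟩ := (hf.associated_of_dvd X_irreducible h).symm
      rw [← hu, map_mul, constantCoeff_X, zero_mul] at hfc
      exact mul_ne_zero (Polynomial.C_ne_zero.2 hc) (pow_ne_zero n (Polynomial.X_sub_C_ne_zero a))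
        hfc.symm
    have := isDiscreteValuationRing_quotient_span hc hn hfc hfX
    have := henselianRing_quotient_span hc hn hfc
    obtain ⟨t, ht⟩ := IsDiscreteValuationRing.exists_irreducible
      ((Polynomial k)⟦X⟧ ⧸ Ideal.span {f})
    have hg0 : Ideal.Quotient.mk (Ideal.span {f}) g ≠ 0 := by
      rw [Ne, Ideal.Quotient.eq_zero_iff_mem, Ideal.mem_span_singleton]
      exact fun h => hfg (hf.associated_of_dvd hg h)
    obtain ⟨j, u, hu⟩ := IsDiscreteValuationRing.eq_unit_mul_pow_irreducible hg0 ht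
    obtain ⟨v, hv⟩ := exists_pow_eq_of_isUnit_of_henselianRing
      (Ideal.span {Ideal.Quotient.mk (Ideal.span {f}) X})
      (fun z hz => ⟨n, pow_mem_span_mk_X_of_mem_maximalIdeal hc hn hfc hz⟩)
      ((Ideal.Quotient.mk _).comp (C.comp Polynomial.C))
      (exists_sub_C_mem_maximalIdeal hc hn hfc) hq u.isUnit
    refine ⟨v, t, j, ?_, ?_, ht.ne_zero, by rw [hv, hu]⟩
    · rw [← (IsDiscreteValuationRing.irreducible_iff_uniformizer t).1 ht]
      infer_instance
    · rw [← isUnit_pow_iff hq0, hv]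
      exact u.isUnit

end PowerSeries

/-! ### Comparison of the two orders. -/

open PowerSeries in
theorem mainTheorem5 {k : Type*} [Field k] [IsAlgClosed k] (q : ℕ) (hq : q.Prime)
    (hqk : q ≠ ringChar k) (f g : PowerSeries (Polynomial k))
    (hf : Irreducible f) (hg : Irreducible g)
    (hns : IsNonsingularCurve f) (hfg : IsPowModulo q f g) :
    IsPowModulo q g f := by
  by_cases hass : Associated f g
  · exact ⟨0, by rw [zero_pow hq.ne_zero, sub_zero]; exact hass.dvd⟩
  have hqk' : (q : k) ≠ 0 := fun h => by
    rcases (Nat.dvd_prime hq).1 (ringChar.dvd h) with h1 | h1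
    · exact CharP.ringChar_ne_one h1
    · exact hqk h1.symm
  have : IsRegularRing (PowerSeries (Polynomial k) ⧸ Ideal.span {f}) := hns
  have : (Ideal.span {f}).IsPrime := (Ideal.span_singleton_prime hf.ne_zero).2 hf.prime
  have : (Ideal.span {g}).IsPrime := (Ideal.span_singleton_prime hg.ne_zero).2 hg.prime
  obtain ⟨s, hs⟩ := hfg
  obtain ⟨v, t, j, ht, hv, ht0, hgt⟩ := exists_quotient_mk_eq_pow_mul_pow hqk' hf hg hass
  have hfs : Ideal.Quotient.mk (Ideal.span {g}) f = Ideal.Quotient.mk (Ideal.span {g}) s ^ q := by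
    rw [← map_pow, Ideal.Quotient.mk_eq_mk_iff_sub_mem, Ideal.mem_span_singleton]
    exact hs
  have hs0 : Ideal.Quotient.mk (Ideal.span {g}) s ≠ 0 := fun h => by
    rw [h, zero_pow hq.ne_zero, Ideal.Quotient.eq_zero_iff_mem, Ideal.mem_span_singleton] at hfs
    exact hass (hg.associated_of_dvd hf hfs).symm
  have hord := Ring.ord_quotient_mk_comm g f
  rw [hfs, hgt, Ring.ord_pow (mem_nonZeroDivisors_of_ne_zero hs0),
    Ring.ord_mul_of_isUnit_left (hv.pow q), Ring.ord_pow (mem_nonZeroDivisors_of_ne_zero ht0),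
    Ring.ord_eq_one_of_isMaximal ht, nsmul_one, nsmul_eq_mul] at hord
  -- `hord` now reads q · ord(s) = j; as j is finite, so is ord(s).
  obtain ⟨i, rfl⟩ : q ∣ j := by
    cases h : Ring.ord _ (Ideal.Quotient.mk (Ideal.span {g}) s) with
    | top =>
      rw [h, ENat.mul_top (by exact_mod_cast hq.ne_zero)] at hord
      exact absurd hord.symm (ENat.natCast_ne_top j)
    | coe l =>
      rw [h] at hord
      exact ⟨l, by exact_mod_cast hord.symm⟩
  obtain ⟨w, hw⟩ := Ideal.Quotient.mk_surjective (v * t ^ i)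
  refine ⟨w, ?_⟩
  rw [← Ideal.mem_span_singleton, ← Ideal.Quotient.mk_eq_mk_iff_sub_mem, hgt, map_pow, hw]
  ring
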